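/- For integers $n\ge 2$ let $$I_n=\int_0^\infty\Big(\frac{\sin x}{x}\Big)^{n}dx,\qquad \hat I_n=\int_0^\pi\Big(\frac{\sin x}{x}\Big)^{n}dx,\qquad R_n=\int_\pi^\infty\Big(\frac{\sin x}{x}\Big)^{n}dx .$$ Let $\psi(x)=\log(x/\sin x)$ for $-\pi<x<\pi$, with $\psi(0)=0$, and let $\tau(x)=\operatorname{sgn}(x)\sqrt{\psi(x)}$. Then $x\mapsto\tau(x)$ is a bijection from $(-\pi,\pi)$ onto $\mathbb R$ with $\tau(x)^2=\log(x/\sin x)$. Let $\tau\mapsto x(\tau)$ be its inverse. There are $r>0$ and real numbers $b_k$ (namely, the Taylor coefficients at $0$) with $$\frac{dx}{d\tau}=\sqrt6\,\sum_{k=0}^\infty b_k\tau^{2k}\qquad(|\tau|<r).$$ Put $$c_k=b_k\,\frac{\Gamma(k+\frac12)}{\Gamma(\frac12)}\qquad(k=0,1,2,\dots).$$ (i) For every $n\ge2$ the integrand of $I_n$ is integrable on $(0,\infty)$, $I_n=\hat I_n+R_n$, and the tail is exponentially small: $$|R_n|<\frac{\pi^{1-n}}{n-1},\qquad R_n=O\big(n^{-1}\pi^{-n}\big)\quad(n\to\infty).$$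 (ii) As $n\to\infty$ through the integers, $\hat I_n$ and $I_n$, which differ only by the exponentially small $R_n$, both have the Poincaré asymptotic expansion $$I_n\sim\sqrt{\frac{3\pi}{2n}}\,\sum_{k=0}^\infty\frac{c_k}{n^k},$$ that is, for every $N\ge0$, $$I_n=\sqrt{\frac{3\pi}{2n}}\,\sum_{k=0}^{N-1}\frac{c_k}{n^k}+O\big(n^{-N-1/2}\big),$$ and likewise with $\hat I_n$ in place of $I_n$. (iii) The coefficients for $0\le k\le12$ are $$c_0=1,\quad c_1=-\tfrac{3}{20},\quad c_2=-\tfrac{13}{1120},\quad c_3=\tfrac{27}{3200},\quad c_4=\tfrac{52791}{3942400},\quad c_5=\tfrac{482427}{66560000},$$ $$c_6=-\tfrac{124996631}{10035200000},\quad c_7=-\tfrac{5270328789}{136478720000},\quad c_8=-\tfrac{7479063506161}{268461670400000},\quad c_9=\tfrac{6921977624613}{56518246400000},$$ $$c_{10}=\tfrac{10703530420192887741}{23658537943040000000},\quad c_{11}=\tfrac{5097105795373974189}{20572641689600000000},\quad c_{12}=-\tfrac{12397974207837236059539}{3620784937369600000000}.$$ (iv) For integers $n\ge1$ the integrand of $$J_n=\int_0^\infty\Big(\frac{1-\cos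 x}{\frac12x^2}\Big)^{n}dx$$ is integrable on $(0,\infty)$, $J_n=2I_{2n}$, and as $n\to\infty$ $$J_n\sim\sqrt{\frac{3\pi}{n}}\,\sum_{k=0}^\infty\frac{c_k}{(2n)^k},$$ that is, for every $N\ge0$, $J_n=\sqrt{3\pi/n}\,\sum_{k=0}^{N-1}c_k(2n)^{-k}+O(n^{-N-1/2})$. -/

import Mathlib

open Filter Asymptotics MeasureTheory

noncomputable section

namespace SincPower

/-- The integrand `(sin x / x) ^ n`. -/
def integrand (n : ℕ) (x : ℝ) : ℝ := (Real.sin x / x) ^ n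

/-- `I n = ∫_0^∞ (sin x / x)^n dx`. -/
def I (n : ℕ) : ℝ := ∫ x in Set.Ioi (0 : ℝ), integrand n x

/-- The main part `∫_0^π (sin x / x)^n dx`. -/
def IHat (n : ℕ) : ℝ := ∫ x in (0 : ℝ)..Real.pi, integrand n x

/-- The tail `∫_π^∞ (sin x / x)^n dx`. -/
def R (n : ℕ) : ℝ := ∫ x in Set.Ioi Real.pi, integrand n x

/-- The integrand `((1 - cos x) / (x² / 2)) ^ n`. -/
def integrandJ (n : ℕ) (x : ℝ) : ℝ := ((1 - Real.cos x) / (x ^ 2 / 2)) ^ n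

/-- `J n = ∫_0^∞ ((1 - cos x) / (x² / 2))^n dx`. -/
def J (n : ℕ) : ℝ := ∫ x in Set.Ioi (0 : ℝ), integrandJ n x

/-- `ψ x = log (x / sin x)`, used for `-π < x < π`; the conventions of Lean give the
continuous value `ψ 0 = 0`. -/
def psi (x : ℝ) : ℝ := Real.log (x / Real.sin x)

/-- The odd solution `τ` of `τ² = ψ x` on `(-π, π)` with the sign of `x`. -/
def tau (x : ℝ) : ℝ := Real.sign x * √(psi x)

/-- The inverse function `τ ↦ x` of `tau : (-π, π) → ℝ`. -/
def xOf : ℝ → ℝ := Function.invFunOn tau (Set.Ioo (-Real.pi) Real.pi)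

/-- `b k` is the coefficient of `τ ^ (2 * k)` in the Taylor series at `0`
of `(dx/dτ) / √6`. -/
def b (k : ℕ) : ℝ :=
  iteratedDeriv (2 * k) (deriv xOf) 0 / (Nat.factorial (2 * k) : ℝ) / √6

/-- `c k = b k * Γ(k + 1/2) / Γ(1/2)`. -/
def c (k : ℕ) : ℝ := b k * (Real.Gamma ((k : ℝ) + 1 / 2) / Real.Gamma (1 / 2))

end SincPower

end

namespace SincPower

open Set Topology

/-! On `(-π, π)` the variable `τ` turns `sinc x` into `exp (-τ ^ 2)`, so the part of the integral
near `0` is a Gaussian integral of `exp (-n τ ^ 2)` against `dx/dτ`. Watson's lemma (`watson`)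
integrates the even Taylor series of `dx/dτ` term by term; the factors `Γ(k + 1/2)` from the
Gaussian moments are those that turn `b k` into `c k`. The rest is negligible: `sinc` decreases on
`[0, π]`, so beyond `xOf ρ` the integrand is at most `exp (-ρ ^ 2 n)` (`tail_sinc_pow_isBigO`), and
beyond `π` it is bounded by `x ^ (-n)` (`abs_R_lt`).

Watson's lemma needs `xOf` to be analytic at `0`. Since `psi x = x ^ 2 * psiQuot x` with `psiQuot`
analytic and positive at `0`, `tau` is locally `x` times an analytic nonvanishing factor, and its
local inverse is analytic (`analyticAt_xOf`).

For the explicit coefficients, put `C = x cot x`, which equals `cos x * exp (τ ^ 2)`.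
Differentiating `sin x = x * exp (-τ ^ 2)` and `C` gives `x' C + 2 τ x = x'` and `C' + x x' = 2 τ
C`, a system free of transcendental functions. Comparing coefficients gives the recursions
`sum_b_mul_cotCoeff` and `cotCoeff_succ`. The integral `J` reduces to `I` by the half-angle formula.
-/

/-! ### Monotonicity of `sinc` and bijectivity of `tau` -/

theorem sin_sub_mul_cos_pos {x : ℝ} (hx : x ∈ Ioo 0 Real.pi) :
    0 < Real.sin x - x * Real.cos x := by
  have hmono : StrictMonoOn (fun y : ℝ => Real.sin y - y * Real.cos y) (Icc 0 Real.pi) := by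
    refine strictMonoOn_of_deriv_pos (convex_Icc _ _) (by fun_prop) fun y hy => ?_
    rw [interior_Icc] at hy
    have hd : HasDerivAt (fun y : ℝ => Real.sin y - y * Real.cos y) (y * Real.sin y) y := by
      have h := (Real.hasDerivAt_sin y).sub ((hasDerivAt_id y).mul (Real.hasDerivAt_cos y))
      refine h.congr_deriv ?_
      simp only [id]
      ring
    rw [hd.deriv]
    exact mul_pos hy.1 (Real.sin_pos_of_mem_Ioo hy)
  have h := hmono (left_mem_Icc.2 Real.pi_pos.le) (Ioo_subset_Icc_self hx) hx.1
  simpa using h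

theorem strictAntiOn_sinc : StrictAntiOn Real.sinc (Icc 0 Real.pi) := by
  refine strictAntiOn_of_deriv_neg (convex_Icc _ _) Real.continuous_sinc.continuousOn
    fun x hx => ?_
  rw [interior_Icc] at hx
  have hd : HasDerivAt Real.sinc ((Real.cos x * x - Real.sin x) / x ^ 2) x := by
    have h := (Real.hasDerivAt_sin x).div (hasDerivAt_id x) hx.1.ne'
    simp only [id, mul_one] at h
    refine h.congr_of_eventuallyEq ?_
    filter_upwards [eventually_ne_nhds hx.1.ne'] with y hy
    simp [Real.sinc_of_ne_zero hy]
  rw [hd.deriv]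
  have h := sin_sub_mul_cos_pos hx
  have h0 := hx.1
  exact div_neg_of_neg_of_pos (by linarith) (by positivity)

theorem sinc_pi : Real.sinc Real.pi = 0 := by
  simp [Real.sinc_of_ne_zero Real.pi_ne_zero]

theorem sinc_abs (x : ℝ) : Real.sinc |x| = Real.sinc x := by
  rcases abs_choice x with h | h <;> simp [h]

theorem sinc_pos {x : ℝ} (hx : x ∈ Ioo (-Real.pi) Real.pi) : 0 < Real.sinc x := by
  rw [← sinc_abs, ← sinc_pi]
  have h := abs_lt.2 hx
  exact strictAntiOn_sinc ⟨abs_nonneg x, h.le⟩ (right_mem_Icc.2 Real.pi_pos.le) h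

theorem psi_eq_neg_log_sinc (x : ℝ) : psi x = -Real.log (Real.sinc x) := by
  rcases eq_or_ne x 0 with rfl | hx
  -- Both sides vanish: `0 / 0 = 0` and `Real.log 0 = 0` on the left, `Real.sinc 0 = 1` on the
  -- right.
  · simp [psi]
  · rw [psi, Real.sinc_of_ne_zero hx, ← Real.log_inv, inv_div]

theorem exp_neg_psi {x : ℝ} (hx : x ∈ Ioo (-Real.pi) Real.pi) :
    Real.exp (-psi x) = Real.sinc x := by
  rw [psi_eq_neg_log_sinc, neg_neg, Real.exp_log (sinc_pos hx)]

theorem psi_nonneg {x : ℝ} (hx : x ∈ Ioo (-Real.pi) Real.pi) : 0 ≤ psi x := by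
  rw [psi_eq_neg_log_sinc, neg_nonneg]
  exact Real.log_nonpos (sinc_pos hx).le (Real.sinc_le_one x)

theorem psi_pos {x : ℝ} (hx : x ∈ Ioo (-Real.pi) Real.pi) (h0 : x ≠ 0) : 0 < psi x := by
  rw [psi_eq_neg_log_sinc, neg_pos]
  refine Real.log_neg (sinc_pos hx) ?_
  rw [← sinc_abs, ← Real.sinc_zero]
  have h := abs_lt.2 hx
  exact strictAntiOn_sinc (left_mem_Icc.2 Real.pi_pos.le) ⟨abs_nonneg x, h.le⟩ (abs_pos.2 h0)

theorem sign_sq_mul_psi (x : ℝ) : Real.sign x ^ 2 * psi x = psi x := by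
  rcases lt_trichotomy x 0 with h | rfl | h
  · simp [Real.sign_of_neg h]
  · simp [psi]
  · simp [Real.sign_of_pos h]

theorem tau_sq {x : ℝ} (hx : x ∈ Ioo (-Real.pi) Real.pi) : tau x ^ 2 = psi x := by
  rw [tau, mul_pow, Real.sq_sqrt (psi_nonneg hx), sign_sq_mul_psi]

theorem tau_of_pos {x : ℝ} (hx : 0 < x) : tau x = √(psi x) := by
  simp [tau, Real.sign_of_pos hx]

theorem tau_zero : tau 0 = 0 := by simp [tau]

theorem tau_neg (x : ℝ) : tau (-x) = -tau x := by
  simp [tau, Real.sign_neg, psi_eq_neg_log_sinc]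

theorem strictMonoOn_tau_Ico : StrictMonoOn tau (Ico 0 Real.pi) := by
  have hmem : ∀ {x : ℝ}, x ∈ Ico 0 Real.pi → x ∈ Ioo (-Real.pi) Real.pi := fun {x} hx =>
    ⟨by linarith [hx.1, Real.pi_pos], hx.2⟩
  intro x hx y hy hxy
  have hy0 : 0 < y := hx.1.trans_lt hxy
  rw [tau_of_pos hy0]
  rcases hx.1.eq_or_lt with h | h
  · rw [← h, tau_zero]
    exact Real.sqrt_pos.2 (psi_pos (hmem hy) hy0.ne')
  · rw [tau_of_pos h]
    refine Real.sqrt_lt_sqrt (psi_nonneg (hmem hx)) ?_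
    rw [psi_eq_neg_log_sinc, psi_eq_neg_log_sinc, neg_lt_neg_iff]
    exact Real.log_lt_log (sinc_pos (hmem hy))
      (strictAntiOn_sinc (Ico_subset_Icc_self hx) (Ico_subset_Icc_self hy) hxy)

theorem strictMonoOn_tau : StrictMonoOn tau (Ioo (-Real.pi) Real.pi) := by
  have hpos : ∀ x ∈ Ioo 0 Real.pi, 0 < tau x := fun x hx => by
    have h := strictMonoOn_tau_Ico (left_mem_Ico.2 Real.pi_pos) ⟨hx.1.le, hx.2⟩ hx.1
    rwa [tau_zero] at h
  intro x hx y hy hxy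
  rcases le_or_gt 0 x with h | h
  · exact strictMonoOn_tau_Ico ⟨h, hx.2⟩ ⟨h.trans hxy.le, hy.2⟩ hxy
  have hx' : -x ∈ Ioo 0 Real.pi := ⟨by linarith, by linarith [hx.1]⟩
  rcases le_or_gt y 0 with h' | h'
  · have := strictMonoOn_tau_Ico (a := -y) (b := -x) ⟨by linarith, by linarith [hy.1]⟩
      ⟨hx'.1.le, hx'.2⟩ (by linarith)
    rw [tau_neg, tau_neg] at this
    linarith
  · have h1 := hpos (-x) hx'
    have h2 := hpos y ⟨h', hy.2⟩
    rw [tau_neg] at h1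
    linarith

theorem exists_tau_eq_of_pos {t : ℝ} (ht : 0 < t) : ∃ x ∈ Ioo 0 Real.pi, tau x = t := by
  have h1 : Real.exp (-t ^ 2) ∈ Ioo (Real.sinc Real.pi) (Real.sinc 0) := by
    rw [sinc_pi, Real.sinc_zero]
    exact ⟨Real.exp_pos _, by rw [← Real.exp_zero]; exact Real.exp_lt_exp.2 (by simp only [neg_lt_zero]; positivity)⟩
  obtain ⟨x, hx, hxt⟩ := intermediate_value_Ioo' Real.pi_pos.le
    Real.continuous_sinc.continuousOn h1
  refine ⟨x, hx, ?_⟩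
  rw [tau_of_pos hx.1, psi_eq_neg_log_sinc, hxt, Real.log_exp, neg_neg, Real.sqrt_sq ht.le]

theorem surjOn_tau : SurjOn tau (Ioo (-Real.pi) Real.pi) univ := by
  intro t _
  rcases lt_trichotomy t 0 with h | rfl | h
  · obtain ⟨x, hx, hxt⟩ := exists_tau_eq_of_pos (neg_pos.2 h)
    exact ⟨-x, ⟨by linarith [hx.2], by linarith [hx.1, Real.pi_pos]⟩, by rw [tau_neg, hxt, neg_neg]⟩
  · exact ⟨0, ⟨by linarith [Real.pi_pos], Real.pi_pos⟩, tau_zero⟩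
  · obtain ⟨x, hx, hxt⟩ := exists_tau_eq_of_pos h
    exact ⟨x, ⟨by linarith [hx.1, Real.pi_pos], hx.2⟩, hxt⟩

theorem bijOn_tau : BijOn tau (Ioo (-Real.pi) Real.pi) univ :=
  ⟨mapsTo_univ _ _, strictMonoOn_tau.injOn, surjOn_tau⟩

theorem xOf_tau {x : ℝ} (hx : x ∈ Ioo (-Real.pi) Real.pi) : xOf (tau x) = x :=
  bijOn_tau.injOn.leftInvOn_invFunOn hx

theorem xOf_mem (t : ℝ) : xOf t ∈ Ioo (-Real.pi) Real.pi :=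
  Function.invFunOn_mem (surjOn_tau (mem_univ t))

theorem tau_xOf (t : ℝ) : tau (xOf t) = t :=
  Function.invFunOn_eq (surjOn_tau (mem_univ t))

theorem xOf_zero : xOf 0 = 0 := by
  have h := xOf_tau (x := 0) ⟨by linarith [Real.pi_pos], Real.pi_pos⟩
  rwa [tau_zero] at h

theorem xOf_neg (t : ℝ) : xOf (-t) = -xOf t := by
  have h := xOf_mem t
  have h2 := xOf_tau (x := -xOf t) ⟨by linarith [h.2], by linarith [h.1]⟩
  rwa [tau_neg, tau_xOf] at h2

theorem sinc_xOf (t : ℝ) : Real.sinc (xOf t) = Real.exp (-t ^ 2) := by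
  rw [← exp_neg_psi (xOf_mem t), ← tau_sq (xOf_mem t), tau_xOf]

theorem sin_xOf (t : ℝ) : Real.sin (xOf t) = xOf t * Real.exp (-t ^ 2) := by
  rw [← sinc_xOf]
  rcases eq_or_ne (xOf t) 0 with h | h
  · simp [h]
  · rw [Real.sinc_of_ne_zero h, mul_div_cancel₀ _ h]

/-! ### Analyticity of `tau` and of its inverse at `0` -/

theorem _root_.AnalyticAt.dslope_self {f : ℝ → ℝ} {a : ℝ} (hf : AnalyticAt ℝ f a) :
    AnalyticAt ℝ (dslope f a) a := by
  obtain ⟨p, hp⟩ := hf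
  exact ⟨_, hp.has_fpower_series_dslope_fslope⟩

theorem eq_mul_dslope_zero {f : ℝ → ℝ} (hf : f 0 = 0) (x : ℝ) : f x = x * dslope f 0 x := by
  have h := sub_smul_dslope f 0 x
  simpa [hf] using h.symm

theorem analyticAt_psi_zero : AnalyticAt ℝ psi 0 := by
  have h1 : AnalyticAt ℝ Real.sinc 0 := by
    rw [Real.sinc_eq_dslope]
    exact Real.analyticAt_sin.dslope_self
  have h2 : psi = fun x => -Real.log (Real.sinc x) := funext psi_eq_neg_log_sinc
  rw [h2]
  exact (h1.log (by simp)).neg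

theorem psi_zero : psi 0 = 0 := by simp [psi]

theorem deriv_eq_zero_of_even {f : ℝ → ℝ} (hf : ∀ x, f (-x) = f x) : deriv f 0 = 0 := by
  have h := deriv_comp_neg f 0
  simp only [hf, neg_zero] at h
  linarith

/-- The quotient `psi x / x ^ 2`, extended continuously to `0`. -/
noncomputable def psiQuot : ℝ → ℝ := dslope (dslope psi 0) 0

theorem analyticAt_psiQuot : AnalyticAt ℝ psiQuot 0 :=
  analyticAt_psi_zero.dslope_self.dslope_self

/-- `psi` is even, so its first derivative at `0` vanishes along with its value, and `x` can be
divided out twice. -/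
theorem psi_eq_sq_mul (x : ℝ) : psi x = x ^ 2 * psiQuot x := by
  have h : dslope psi 0 0 = 0 := by
    rw [dslope_same]
    exact deriv_eq_zero_of_even fun x => by simp [psi_eq_neg_log_sinc]
  rw [eq_mul_dslope_zero psi_zero, eq_mul_dslope_zero h, psiQuot]
  ring

/-- A crude quadratic lower bound, needed only for `psiQuot 0 > 0`. The constant `1 / 10` lies below
the leading coefficient `1 / 6` to absorb the error in `Real.sin_bound`. -/
theorem sq_div_ten_le_psi {x : ℝ} (h0 : 0 < x) (h1 : x ≤ 1) : x ^ 2 / 10 ≤ psi x := by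
  have hb := (abs_le.1 (Real.sin_bound (x := x) (by rwa [abs_of_pos h0]))).2
  rw [abs_of_pos h0] at hb
  have hs : Real.sinc x ≤ 1 - x ^ 2 / 10 := by
    rw [Real.sinc_of_ne_zero h0.ne', div_le_iff₀ h0]
    have h5 : x ^ 5 ≤ x ^ 3 := pow_le_pow_of_le_one h0.le h1 (by norm_num)
    nlinarith [pow_pos h0 3]
  have hpos : 0 < Real.sinc x := sinc_pos ⟨by linarith [Real.pi_pos], by linarith [Real.pi_gt_three]⟩
  rw [psi_eq_neg_log_sinc]
  have := Real.log_le_sub_one_of_pos hpos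
  linarith

theorem psiQuot_zero_pos : 0 < psiQuot 0 := by
  have hc : Tendsto psiQuot (𝓝[>] 0) (𝓝 (psiQuot 0)) :=
    analyticAt_psiQuot.continuousAt.tendsto.mono_left nhdsWithin_le_nhds
  have h : 1 / 10 ≤ psiQuot 0 := by
    refine ge_of_tendsto hc ?_
    filter_upwards [Ioc_mem_nhdsGT (zero_lt_one' ℝ)] with x hx
    have := sq_div_ten_le_psi hx.1 hx.2
    rw [psi_eq_sq_mul] at this
    have h2 : 0 < x ^ 2 := pow_pos hx.1 2
    nlinarith
  linarith

/-- The square root of `x ^ 2 * psiQuot x` contributes `|x|`, and the sign in `tau` turns it back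
into `x`; the two singularities at `0` cancel. -/
theorem tau_eventuallyEq :
    tau =ᶠ[𝓝 0] fun x => x * Real.exp (Real.log (psiQuot x) / 2) := by
  filter_upwards [analyticAt_psiQuot.continuousAt.eventually (lt_mem_nhds psiQuot_zero_pos)]
    with x hx
  rw [← Real.log_sqrt hx.le, Real.exp_log (Real.sqrt_pos.2 hx), tau, psi_eq_sq_mul,
    Real.sqrt_mul (sq_nonneg x), Real.sqrt_sq_eq_abs, ← mul_assoc]
  congr 1
  rcases lt_trichotomy x 0 with h | rfl | h
  · simp [Real.sign_of_neg h, abs_of_neg h]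
  · simp
  · simp [Real.sign_of_pos h, abs_of_pos h]

theorem analyticAt_tau : AnalyticAt ℝ tau 0 := by
  refine AnalyticAt.congr ?_ tau_eventuallyEq.symm
  have h := (analyticAt_psiQuot.log psiQuot_zero_pos).div_const (c := 2)
  exact analyticAt_id.mul h.rexp

theorem deriv_tau_zero_pos : 0 < deriv tau 0 := by
  rw [tau_eventuallyEq.deriv_eq]
  have h := ((analyticAt_psiQuot.log psiQuot_zero_pos).div_const (c := 2)).rexp
  have hd := (hasDerivAt_id (0 : ℝ)).mul h.differentiableAt.hasDerivAt
  have he : deriv (fun x => x * Real.exp (Real.log (psiQuot x) / 2)) 0 =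
      Real.exp (Real.log (psiQuot 0) / 2) := by
    refine (hd.congr_deriv ?_).deriv
    simp
  rw [he]
  exact Real.exp_pos _

theorem xOf_comp_tau_eventuallyEq : xOf ∘ tau =ᶠ[𝓝 0] id := by
  filter_upwards [Ioo_mem_nhds (neg_lt_zero.2 Real.pi_pos) Real.pi_pos] with x hx
  exact xOf_tau hx

/-- Composition with an analytic map of nonzero derivative reflects analyticity, and `xOf ∘ tau` is
locally the identity. -/
theorem analyticAt_xOf : AnalyticAt ℝ xOf 0 := by
  have h := (analyticAt_comp_iff_of_deriv_ne_zero (g := xOf) analyticAt_tau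
    deriv_tau_zero_pos.ne').1 (analyticAt_id.congr xOf_comp_tau_eventuallyEq.symm)
  rwa [tau_zero] at h

theorem deriv_xOf_zero_pos : 0 < deriv xOf 0 := by
  have h1 : HasDerivAt xOf (deriv xOf 0) (tau 0) := by
    rw [tau_zero]
    exact analyticAt_xOf.differentiableAt.hasDerivAt
  have h2 := (h1.comp 0 analyticAt_tau.differentiableAt.hasDerivAt).deriv
  rw [xOf_comp_tau_eventuallyEq.deriv_eq, deriv_id] at h2
  have h3 := deriv_tau_zero_pos
  by_contra! h
  nlinarith

theorem deriv_xOf_neg (t : ℝ) : deriv xOf (-t) = deriv xOf t := by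
  have h := deriv_comp_neg xOf t
  simp only [xOf_neg, deriv.fun_neg] at h
  linarith

/-! ### Parity and the Taylor expansion of `dx/dτ` -/

theorem iteratedDeriv_eq_zero_of_even {f : ℝ → ℝ} (hf : ∀ x, f (-x) = f x) {n : ℕ}
    (hn : Odd n) : iteratedDeriv n f 0 = 0 := by
  have h := iteratedDeriv_comp_neg n f 0
  simp only [hf, neg_zero, hn.neg_one_pow, smul_eq_mul] at h
  linarith

theorem iteratedDeriv_eq_zero_of_odd {f : ℝ → ℝ} (hf : ∀ x, f (-x) = -f x) {n : ℕ}
    (hn : Even n) : iteratedDeriv n f 0 = 0 := by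
  have h := iteratedDeriv_comp_neg n f 0
  simp only [hf, neg_zero, hn.neg_one_pow, smul_eq_mul] at h
  rw [show (fun x => -f x) = -f from rfl, iteratedDeriv_neg] at h
  linarith

theorem eventually_hasSum_deriv_xOf :
    ∀ᶠ t in 𝓝 (0 : ℝ), HasSum (fun k : ℕ => √6 * (b k * t ^ (2 * k))) (deriv xOf t) := by
  filter_upwards [hasFPowerSeriesAt_iff.1 analyticAt_xOf.deriv.hasFPowerSeriesAt] with t ht
  simp only [zero_add, FormalMultilinearSeries.coeff_ofScalars, smul_eq_mul] at ht
  have hinj : Function.Injective fun k : ℕ => 2 * k := fun a b h => by simpa using h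
  rw [← hinj.hasSum_iff] at ht
  · refine ht.congr_fun fun k => ?_
    have h6 : √(6 : ℝ) ≠ 0 := by positivity
    simp only [Function.comp_apply, b]
    field_simp
  · intro n hn
    have hodd : Odd n := by
      rw [← Nat.not_even_iff_odd]
      rintro ⟨k, rfl⟩
      exact hn ⟨k, by simp; ring⟩
    rw [iteratedDeriv_eq_zero_of_even deriv_xOf_neg hodd]
    simp

theorem exists_hasSum_deriv_xOf : ∃ r : ℝ, 0 < r ∧ ∀ t : ℝ, |t| < r →
    AnalyticAt ℝ xOf t ∧
      HasSum (fun k : ℕ => √6 * (b k * t ^ (2 * k))) (deriv xOf t) := by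
  obtain ⟨r, hr, h⟩ := Metric.eventually_nhds_iff.1
    (analyticAt_xOf.eventually_analyticAt.and eventually_hasSum_deriv_xOf)
  exact ⟨r, hr, fun t ht => h (by simpa using ht)⟩

/-! ### Formal Taylor series -/

/-- The formal Taylor series at `0`. -/
noncomputable def taylorSeries (f : ℝ → ℝ) : PowerSeries ℝ :=
  PowerSeries.mk fun n => iteratedDeriv n f 0 / (n.factorial : ℝ)

theorem coeff_taylorSeries (f : ℝ → ℝ) (n : ℕ) :
    PowerSeries.coeff n (taylorSeries f) = iteratedDeriv n f 0 / (n.factorial : ℝ) :=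
  PowerSeries.coeff_mk _ _

theorem taylorSeries_congr {f g : ℝ → ℝ} (h : f =ᶠ[𝓝 0] g) : taylorSeries f = taylorSeries g := by
  ext n
  rw [coeff_taylorSeries, coeff_taylorSeries, h.iteratedDeriv_eq]

theorem taylorSeries_add {f g : ℝ → ℝ} (hf : AnalyticAt ℝ f 0) (hg : AnalyticAt ℝ g 0) :
    taylorSeries (f + g) = taylorSeries f + taylorSeries g := by
  ext n
  rw [map_add, coeff_taylorSeries, coeff_taylorSeries, coeff_taylorSeries,
    iteratedDeriv_add hf.contDiffAt hg.contDiffAt, add_div]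

theorem taylorSeries_mul {f g : ℝ → ℝ} (hf : AnalyticAt ℝ f 0) (hg : AnalyticAt ℝ g 0) :
    taylorSeries (f * g) = taylorSeries f * taylorSeries g := by
  ext n
  rw [coeff_taylorSeries, iteratedDeriv_mul hf.contDiffAt hg.contDiffAt, PowerSeries.coeff_mul,
    Finset.Nat.sum_antidiagonal_eq_sum_range_succ_mk, Finset.sum_div]
  refine Finset.sum_congr rfl fun i hi => ?_
  have hi' : i ≤ n := Nat.lt_succ_iff.1 (Finset.mem_range.1 hi)
  rw [coeff_taylorSeries, coeff_taylorSeries, Nat.cast_choose ℝ hi']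
  have h1 : (n.factorial : ℝ) ≠ 0 := by positivity
  have h2 : (i.factorial : ℝ) ≠ 0 := by positivity
  have h3 : ((n - i).factorial : ℝ) ≠ 0 := by positivity
  field_simp

theorem coeff_taylorSeries_deriv (f : ℝ → ℝ) (n : ℕ) :
    PowerSeries.coeff n (taylorSeries (deriv f)) =
      (n + 1) * PowerSeries.coeff (n + 1) (taylorSeries f) := by
  rw [coeff_taylorSeries, coeff_taylorSeries, iteratedDeriv_succ', Nat.factorial_succ]
  have h1 : (n.factorial : ℝ) ≠ 0 := by positivity
  push_cast
  field_simp

theorem taylorSeries_two_mul_id :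
    taylorSeries (fun t => 2 * t) = PowerSeries.C 2 * PowerSeries.X := by
  ext n
  have hd : deriv (fun t : ℝ => 2 * t) = fun _ => 2 := by
    funext t
    simp
  rw [PowerSeries.coeff_C_mul, PowerSeries.coeff_X, coeff_taylorSeries]
  rcases n with _ | n
  · simp
  · rw [iteratedDeriv_succ', hd, iteratedDeriv_const]
    rcases n with _ | n <;> simp

/-- If `F` has no odd coefficients, the even coefficients of `F * G` are a convolution of even
coefficients. -/
theorem coeff_two_mul_mul_of_even {F G : PowerSeries ℝ}
    (hF : ∀ n, Odd n → PowerSeries.coeff n F = 0) (k : ℕ) :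
    PowerSeries.coeff (2 * k) (F * G) = ∑ i ∈ Finset.range (k + 1),
      PowerSeries.coeff (2 * i) F * PowerSeries.coeff (2 * (k - i)) G := by
  rw [PowerSeries.coeff_mul, Finset.Nat.sum_antidiagonal_eq_sum_range_succ_mk]
  symm
  refine Finset.sum_of_injOn (fun i => 2 * i) (fun a _ b _ h => by simpa using h) ?_ ?_ ?_
  · intro i hi
    simp only [Finset.coe_range, mem_Iio] at hi ⊢
    omega
  · intro n hn hn'
    simp only [Finset.mem_range] at hn
    have hodd : Odd n := by
      rw [← Nat.not_even_iff_odd]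
      rintro ⟨m, rfl⟩
      exact hn' ⟨m, by simp only [Finset.coe_range, mem_Iio]; omega, by ring⟩
    simp [hF n hodd]
  · intro i _
    simp only [Nat.mul_sub]

/-! ### Differential equations for `xOf` and `cosExp`, and the recursions -/

/-- The function `x cot x` in terms of the variable `τ`. -/
noncomputable def cosExp (t : ℝ) : ℝ := Real.cos (xOf t) * Real.exp (t ^ 2)

theorem analyticAt_cosExp : AnalyticAt ℝ cosExp 0 := by
  have h1 : AnalyticAt ℝ (fun t => Real.cos (xOf t)) 0 :=
    Real.analyticAt_cos.comp analyticAt_xOf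
  have h2 : AnalyticAt ℝ (fun t : ℝ => Real.exp (t ^ 2)) 0 := (analyticAt_id.pow 2).rexp
  exact h1.mul h2

theorem exp_neg_mul_exp_sq (t : ℝ) : Real.exp (-t ^ 2) * Real.exp (t ^ 2) = 1 := by
  rw [← Real.exp_add]
  simp

theorem hasDerivAt_exp_neg_sq (t : ℝ) :
    HasDerivAt (fun t : ℝ => Real.exp (-t ^ 2)) (-(2 * t) * Real.exp (-t ^ 2)) t := by
  refine ((hasDerivAt_pow 2 t).neg.exp).congr_deriv ?_
  simp
  ring

theorem hasDerivAt_exp_sq (t : ℝ) :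
    HasDerivAt (fun t : ℝ => Real.exp (t ^ 2)) (2 * t * Real.exp (t ^ 2)) t := by
  refine ((hasDerivAt_pow 2 t).exp).congr_deriv ?_
  simp
  ring

/-- This is the derivative of `sin x = x * exp (-t ^ 2)`, multiplied by `exp (t ^ 2)`. -/
theorem deriv_xOf_mul_cosExp {t : ℝ} (ht : DifferentiableAt ℝ xOf t) :
    deriv xOf t * cosExp t + 2 * t * xOf t = deriv xOf t := by
  have hx := ht.hasDerivAt
  have h1 := (hx.mul (hasDerivAt_exp_neg_sq t))
  have h2 := hx.sin
  have h3 : (fun t => Real.sin (xOf t)) = xOf * fun t => Real.exp (-t ^ 2) := funext sin_xOf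
  rw [h3] at h2
  have h4 := h2.unique h1
  have h5 := exp_neg_mul_exp_sq t
  rw [cosExp]
  linear_combination Real.exp (t ^ 2) * h4 + (deriv xOf t - 2 * t * xOf t) * h5

/-- In the product rule, `sin x * exp (t ^ 2)` collapses to `x`. -/
theorem deriv_cosExp {t : ℝ} (ht : DifferentiableAt ℝ xOf t) :
    deriv cosExp t + xOf t * deriv xOf t = 2 * t * cosExp t := by
  have h1 : HasDerivAt cosExp _ t := ht.hasDerivAt.cos.mul (hasDerivAt_exp_sq t)
  rw [h1.deriv, sin_xOf, cosExp]
  have h5 := exp_neg_mul_exp_sq t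
  linear_combination (-xOf t * deriv xOf t) * h5

theorem taylorSeries_deriv_xOf_mul_cosExp :
    taylorSeries (deriv xOf) * taylorSeries cosExp +
      PowerSeries.C 2 * PowerSeries.X * taylorSeries xOf = taylorSeries (deriv xOf) := by
  have hid : AnalyticAt ℝ (fun t : ℝ => 2 * t) 0 := analyticAt_const.mul analyticAt_id
  rw [← taylorSeries_two_mul_id, ← taylorSeries_mul analyticAt_xOf.deriv analyticAt_cosExp,
    ← taylorSeries_mul hid analyticAt_xOf, ← taylorSeries_add
      (analyticAt_xOf.deriv.mul analyticAt_cosExp) (hid.mul analyticAt_xOf)]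
  refine taylorSeries_congr ?_
  filter_upwards [analyticAt_xOf.eventually_analyticAt] with t ht
  exact deriv_xOf_mul_cosExp ht.differentiableAt

theorem taylorSeries_deriv_cosExp :
    taylorSeries (deriv cosExp) + taylorSeries xOf * taylorSeries (deriv xOf) =
      PowerSeries.C 2 * PowerSeries.X * taylorSeries cosExp := by
  have hid : AnalyticAt ℝ (fun t : ℝ => 2 * t) 0 := analyticAt_const.mul analyticAt_id
  rw [← taylorSeries_two_mul_id, ← taylorSeries_mul analyticAt_xOf analyticAt_xOf.deriv,
    ← taylorSeries_mul hid analyticAt_cosExp, ← taylorSeries_add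
      analyticAt_cosExp.deriv (analyticAt_xOf.mul analyticAt_xOf.deriv)]
  refine taylorSeries_congr ?_
  filter_upwards [analyticAt_xOf.eventually_analyticAt] with t ht
  exact deriv_cosExp ht.differentiableAt

theorem coeff_taylorSeries_xOf_even {n : ℕ} (hn : Even n) :
    PowerSeries.coeff n (taylorSeries xOf) = 0 := by
  rw [coeff_taylorSeries, iteratedDeriv_eq_zero_of_odd xOf_neg hn, zero_div]

theorem coeff_taylorSeries_deriv_xOf_odd (n : ℕ) (hn : Odd n) :
    PowerSeries.coeff n (taylorSeries (deriv xOf)) = 0 := by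
  rw [coeff_taylorSeries, iteratedDeriv_eq_zero_of_even deriv_xOf_neg hn, zero_div]

/-- The coefficient of `t ^ (2 * k)` in the Taylor series of `cosExp`. -/
noncomputable def cotCoeff (k : ℕ) : ℝ := PowerSeries.coeff (2 * k) (taylorSeries cosExp)

theorem coeff_cosExp (k : ℕ) :
    PowerSeries.coeff (2 * k) (taylorSeries cosExp) = cotCoeff k := rfl

theorem cotCoeff_zero : cotCoeff 0 = 1 := by
  simp [cotCoeff, coeff_taylorSeries, cosExp, xOf_zero]

theorem coeff_taylorSeries_deriv_xOf (k : ℕ) :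
    PowerSeries.coeff (2 * k) (taylorSeries (deriv xOf)) = √6 * b k := by
  have h6 : √(6 : ℝ) ≠ 0 := by positivity
  rw [coeff_taylorSeries, b]
  field_simp

theorem coeff_taylorSeries_xOf_odd (k : ℕ) :
    PowerSeries.coeff (2 * k + 1) (taylorSeries xOf) = √6 * (b k / (2 * k + 1)) := by
  have h := coeff_taylorSeries_deriv xOf (2 * k)
  rw [coeff_taylorSeries_deriv_xOf] at h
  have h2 : (2 * (k : ℝ) + 1) ≠ 0 := by positivity
  push_cast at h
  field_simp
  linear_combination -h

theorem sum_b_mul_cotCoeff (k : ℕ) :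
    ∑ i ∈ Finset.range (k + 1), b i * cotCoeff (k + 1 - i) = -2 * (b k / (2 * k + 1)) := by
  have h := congrArg (PowerSeries.coeff (2 * (k + 1))) taylorSeries_deriv_xOf_mul_cosExp
  rw [map_add, coeff_two_mul_mul_of_even coeff_taylorSeries_deriv_xOf_odd, mul_assoc,
    PowerSeries.coeff_C_mul, show 2 * (k + 1) = 2 * k + 1 + 1 by ring,
    PowerSeries.coeff_succ_X_mul, coeff_taylorSeries_xOf_odd,
    show 2 * k + 1 + 1 = 2 * (k + 1) by ring, Finset.sum_range_succ, Nat.sub_self,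
    coeff_cosExp, cotCoeff_zero] at h
  simp only [coeff_taylorSeries_deriv_xOf, coeff_cosExp] at h
  have h6 : √(6 : ℝ) ≠ 0 := by positivity
  simp only [mul_assoc, ← Finset.mul_sum] at h
  apply mul_left_cancel₀ h6
  linear_combination h

theorem cotCoeff_succ (k : ℕ) :
    (2 * k + 2) * cotCoeff (k + 1) =
      -6 * ∑ i ∈ Finset.range (k + 1), b i / (2 * i + 1) * b (k - i) + 2 * cotCoeff k := by
  -- The series of `xOf` is odd; dividing by `X` leaves an even series, to which
  -- `coeff_two_mul_mul_of_even` applies.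
  obtain ⟨Q, hQ⟩ : PowerSeries.X ∣ taylorSeries xOf := by
    rw [PowerSeries.X_dvd_iff, ← PowerSeries.coeff_zero_eq_constantCoeff_apply]
    exact coeff_taylorSeries_xOf_even Even.zero
  have hcoeff : ∀ n, PowerSeries.coeff n Q = PowerSeries.coeff (n + 1) (taylorSeries xOf) := by
    intro n
    rw [hQ, PowerSeries.coeff_succ_X_mul]
  have hodd : ∀ n, Odd n → PowerSeries.coeff n Q = 0 := fun n hn => by
    rw [hcoeff]
    exact coeff_taylorSeries_xOf_even hn.add_one
  have h := congrArg (PowerSeries.coeff (2 * k + 1)) taylorSeries_deriv_cosExp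
  rw [map_add, hQ, mul_assoc, PowerSeries.coeff_succ_X_mul, coeff_two_mul_mul_of_even hodd,
    mul_assoc, PowerSeries.coeff_C_mul, PowerSeries.coeff_succ_X_mul,
    coeff_taylorSeries_deriv, show 2 * k + 1 + 1 = 2 * (k + 1) by ring] at h
  simp only [hcoeff, coeff_taylorSeries_xOf_odd, coeff_taylorSeries_deriv_xOf, coeff_cosExp] at h
  have h6 : √(6 : ℝ) * √6 = 6 := Real.mul_self_sqrt (by norm_num)
  have h7 : ∀ i : ℕ, √6 * (b i / (2 * i + 1)) * (√6 * b (k - i)) =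
      6 * (b i / (2 * i + 1) * b (k - i)) := fun i => by
    linear_combination (b i / (2 * i + 1) * b (k - i)) * h6
  simp only [h7, ← Finset.mul_sum] at h
  push_cast at h
  linear_combination h

/-- At order zero the first recursion gives `cotCoeff 1 = -2`, and the second then gives `b 0 ^ 2 =
1`. The sign comes from `xOf` being increasing at `0`. -/
theorem b_zero : b 0 = 1 := by
  have h1 := sum_b_mul_cotCoeff 0
  have h2 := cotCoeff_succ 0
  have h3 : 0 < b 0 := by
    have : b 0 = deriv xOf 0 / √6 := by simp [b]
    rw [this]
    exact div_pos deriv_xOf_zero_pos (by positivity)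
  simp [cotCoeff_zero] at h1 h2
  have h4 : cotCoeff 1 = -2 := by
    apply mul_left_cancel₀ h3.ne'
    linarith
  rw [h4] at h2
  nlinarith

/-! ### Explicit coefficients -/

theorem b_values :
    b 0 = 1 ∧
    b 1 = -(3 / 10) ∧
    b 2 = -(13 / 840) ∧
    b 3 = 9 / 2000 ∧
    b 4 = 17597 / 8624000 ∧
    b 5 = 53603 / 218400000 ∧
    b 6 = -(124996631 / 1629936000000) ∧
    b 7 = -(159706933 / 4366252800000) ∧
    b 8 = -(575312577397 / 163515179520000000) ∧
    b 9 = 45241683821 / 24861957120000000 ∧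
    b 10 = 7773079462739933 / 10985393875456000000000 ∧
    b 11 = 9935878743419053 / 269230133652480000000000 ∧
    b 12 = -(4132658069279078686513 / 93181626177657937920000000000) := by
  have b0 := b_zero
  have d0 := cotCoeff_zero
  have d1 : cotCoeff 1 = -2 := by
    have h := cotCoeff_succ 0
    norm_num [b0, d0] at h
    linarith
  -- From here on, the two recursions at index `k` form a nonsingular linear system in the two
  -- unknowns `b k` and `cotCoeff (k + 1)`, all other entries being known.
  obtain ⟨b1, d2⟩ : b 1 = -(3 / 10) ∧ cotCoeff 2 = -(2 / 5) := by
    have h := sum_b_mul_cotCoeff 1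
    have h' := cotCoeff_succ 1
    norm_num [Finset.sum_range_succ, b0, d1] at h h'
    constructor <;> linarith
  obtain ⟨b2, d3⟩ : b 2 = -(13 / 840) ∧ cotCoeff 3 = -(76 / 525) := by
    have h := sum_b_mul_cotCoeff 2
    have h' := cotCoeff_succ 2
    norm_num [Finset.sum_range_succ, b0, b1, d1, d2] at h h'
    constructor <;> linarith
  obtain ⟨b3, d4⟩ : b 3 = 9 / 2000 ∧ cotCoeff 4 = -(22 / 525) := by
    have h := sum_b_mul_cotCoeff 3
    have h' := cotCoeff_succ 3
    norm_num [Finset.sum_range_succ, b0, b1, b2, d1, d2, d3] at h h'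
    constructor <;> linarith
  obtain ⟨b4, d5⟩ : b 4 = 17597 / 8624000 ∧ cotCoeff 5 = -(9484 / 1010625) := by
    have h := sum_b_mul_cotCoeff 4
    have h' := cotCoeff_succ 4
    norm_num [Finset.sum_range_succ, b0, b1, b2, b3, d1, d2, d3, d4] at h h'
    constructor <;> linarith
  obtain ⟨b5, d6⟩ : b 5 = 53603 / 218400000 ∧ cotCoeff 6 = -(43636 / 28153125) := by
    have h := sum_b_mul_cotCoeff 5
    have h' := cotCoeff_succ 5
    norm_num [Finset.sum_range_succ, b0, b1, b2, b3, b4, d1, d2, d3, d4, d5] at h h'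
    constructor <;> linarith
  obtain ⟨b6, d7⟩ : b 6 = -(124996631 / 1629936000000) ∧ cotCoeff 7 = -(1170296 / 6897515625) := by
    have h := sum_b_mul_cotCoeff 6
    have h' := cotCoeff_succ 6
    norm_num [Finset.sum_range_succ, b0, b1, b2, b3, b4, b5, d1, d2, d3, d4, d5, d6] at h h'
    constructor <;> linarith
  obtain ⟨b7, d8⟩ : b 7 = -(159706933 / 4366252800000) ∧ cotCoeff 8 = -(68146 / 6442734375) := by
    have h := sum_b_mul_cotCoeff 7
    have h' := cotCoeff_succ 7
    norm_num [Finset.sum_range_succ, b0, b1, b2, b3, b4, b5, b6, d1, d2, d3, d4, d5, d6, d7] at h h'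
    constructor <;> linarith
  obtain ⟨b8, d9⟩ : b 8 = -(575312577397 / 163515179520000000) ∧ cotCoeff 9 = -(13481438132 / 7719664999921875) := by
    have h := sum_b_mul_cotCoeff 8
    have h' := cotCoeff_succ 8
    norm_num [Finset.sum_range_succ, b0, b1, b2, b3, b4, b5, b6, b7, d1, d2, d3, d4, d5, d6, d7, d8] at h h'
    constructor <;> linarith
  obtain ⟨b9, d10⟩ : b 9 = 45241683821 / 24861957120000000 ∧ cotCoeff 10 = -(1477499396 / 1594972107421875) := by
    have h := sum_b_mul_cotCoeff 9
    have h' := cotCoeff_succ 9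
    norm_num [Finset.sum_range_succ, b0, b1, b2, b3, b4, b5, b6, b7, b8, d1, d2, d3, d4, d5, d6, d7, d8, d9] at h h'
    constructor <;> linarith
  obtain ⟨b10, d11⟩ : b 10 = 7773079462739933 / 10985393875456000000000 ∧ cotCoeff 11 = -(62558100081448 / 288522479372080078125) := by
    have h := sum_b_mul_cotCoeff 10
    have h' := cotCoeff_succ 10
    norm_num [Finset.sum_range_succ, b0, b1, b2, b3, b4, b5, b6, b7, b8, b9, d1, d2, d3, d4, d5, d6, d7, d8, d9, d10] at h h'
    constructor <;> linarith
  obtain ⟨b11, d12⟩ : b 11 = 9935878743419053 / 269230133652480000000000 ∧ cotCoeff 12 = -(24071651452 / 30264595738330078125) := by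
    have h := sum_b_mul_cotCoeff 11
    have h' := cotCoeff_succ 11
    norm_num [Finset.sum_range_succ, b0, b1, b2, b3, b4, b5, b6, b7, b8, b9, b10, d1, d2, d3, d4, d5, d6, d7, d8, d9, d10, d11] at h h'
    constructor <;> linarith
  obtain ⟨b12, d13⟩ : b 12 = -(4132658069279078686513 / 93181626177657937920000000000) ∧ cotCoeff 13 = 20503830686632984 / 1666217318373762451171875 := by
    have h := sum_b_mul_cotCoeff 12
    have h' := cotCoeff_succ 12
    norm_num [Finset.sum_range_succ, b0, b1, b2, b3, b4, b5, b6, b7, b8, b9, b10, b11, d1, d2, d3, d4, d5, d6, d7, d8, d9, d10, d11, d12] at h h'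
    constructor <;> linarith
  exact ⟨b0, b1, b2, b3, b4, b5, b6, b7, b8, b9, b10, b11, b12⟩

/-- For `k = 0` the truncated subtraction gives `0‼ = 1`, the right value in place of `(-1)‼`. -/
theorem c_eq (k : ℕ) : c k = b k * ((2 * k - 1).doubleFactorial / 2 ^ k) := by
  have h := Real.Gamma_nat_add_half k
  have hpi : √Real.pi ≠ 0 := by positivity
  rw [c, h, Real.Gamma_one_half_eq]
  field_simp

theorem c_values :
    c 0 = 1 ∧
    c 1 = -(3 / 20) ∧
    c 2 = -(13 / 1120) ∧
    c 3 = 27 / 3200 ∧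
    c 4 = 52791 / 3942400 ∧
    c 5 = 482427 / 66560000 ∧
    c 6 = -(124996631 / 10035200000) ∧
    c 7 = -(5270328789 / 136478720000) ∧
    c 8 = -(7479063506161 / 268461670400000) ∧
    c 9 = 6921977624613 / 56518246400000 ∧
    c 10 = 10703530420192887741 / 23658537943040000000 ∧
    c 11 = 5097105795373974189 / 20572641689600000000 ∧
    c 12 = -(12397974207837236059539 / 3620784937369600000000) := by
  obtain ⟨b0, b1, b2, b3, b4, b5, b6, b7, b8, b9, b10, b11, b12⟩ := b_values
  simp only [c_eq, b0, b1, b2, b3, b4, b5, b6, b7, b8, b9, b10, b11, b12]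
  norm_num [Nat.doubleFactorial]

/-! ### Integrability, splitting at `π`, and the tail -/

theorem integrand_eq_sinc_pow (n : ℕ) {x : ℝ} (hx : x ≠ 0) : integrand n x = Real.sinc x ^ n := by
  rw [integrand, Real.sinc_of_ne_zero hx]

theorem measurable_integrand (n : ℕ) : Measurable (integrand n) :=
  (Real.measurable_sin.div measurable_id).pow_const n

theorem integrableOn_integrand_Ioc (n : ℕ) (a : ℝ) : IntegrableOn (integrand n) (Ioc 0 a) := by
  have h : IntegrableOn (fun x => Real.sinc x ^ n) (Ioc 0 a) :=
    ((Real.continuous_sinc.pow n).integrableOn_Icc).mono_set Ioc_subset_Icc_self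
  exact h.congr_fun (fun x hx => (integrand_eq_sinc_pow n hx.1.ne').symm) measurableSet_Ioc

theorem abs_integrand_le (n : ℕ) {x : ℝ} (hx : 0 < x) : |integrand n x| ≤ x ^ (-(n : ℝ)) := by
  rw [integrand, abs_pow, abs_div, abs_of_pos hx, div_pow, Real.rpow_neg hx.le,
    Real.rpow_natCast, div_eq_mul_inv]
  exact mul_le_of_le_one_left (by positivity) (pow_le_one₀ (abs_nonneg _) (Real.abs_sin_le_one x))

theorem integrableOn_rpow_neg {n : ℕ} (hn : 2 ≤ n) :
    IntegrableOn (fun x : ℝ => x ^ (-(n : ℝ))) (Ioi Real.pi) := by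
  have : (2 : ℝ) ≤ n := by exact_mod_cast hn
  exact integrableOn_Ioi_rpow_of_lt (by linarith) Real.pi_pos

theorem integrableOn_integrand_Ioi_pi {n : ℕ} (hn : 2 ≤ n) :
    IntegrableOn (integrand n) (Ioi Real.pi) := by
  refine (integrableOn_rpow_neg hn).mono' (measurable_integrand n).aestronglyMeasurable ?_
  filter_upwards [ae_restrict_mem measurableSet_Ioi] with x hx
  exact abs_integrand_le n (Real.pi_pos.trans hx)

theorem integrableOn_integrand {n : ℕ} (hn : 2 ≤ n) : IntegrableOn (integrand n) (Ioi 0) := by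
  rw [← Ioc_union_Ioi_eq_Ioi Real.pi_pos.le]
  exact (integrableOn_integrand_Ioc n _).union (integrableOn_integrand_Ioi_pi hn)

theorem I_eq_IHat_add_R {n : ℕ} (hn : 2 ≤ n) : I n = IHat n + R n := by
  rw [I, IHat, R, intervalIntegral.integral_of_le Real.pi_pos.le,
    ← setIntegral_union (Ioc_disjoint_Ioi le_rfl) measurableSet_Ioi
      (integrableOn_integrand_Ioc n _) (integrableOn_integrand_Ioi_pi hn),
    Ioc_union_Ioi_eq_Ioi Real.pi_pos.le]

theorem abs_sin_lt_one {x : ℝ} (hx : x ∈ Ioo Real.pi (Real.pi + Real.pi / 2)) :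
    |Real.sin x| < 1 := by
  have h : Real.cos x < 0 :=
    Real.cos_neg_of_pi_div_two_lt_of_lt (by linarith [hx.1, Real.pi_pos]) hx.2
  rw [← sq_lt_one_iff_abs_lt_one]
  nlinarith [Real.sin_sq_add_cos_sq x]

theorem abs_R_lt {n : ℕ} (hn : 2 ≤ n) :
    |R n| < Real.pi ^ (1 - (n : ℤ)) / ((n : ℝ) - 1) := by
  have hn' : (2 : ℝ) ≤ n := by exact_mod_cast hn
  have hint : ∫ x in Ioi Real.pi, x ^ (-(n : ℝ)) = Real.pi ^ (1 - (n : ℤ)) / ((n : ℝ) - 1) := by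
    rw [integral_Ioi_rpow_of_lt (by linarith) Real.pi_pos, ← Real.rpow_intCast, neg_div,
      ← div_neg]
    congr 1
    · push_cast
      ring_nf
    · ring
  have habs := (integrableOn_integrand_Ioi_pi hn).abs
  have hsub : IntegrableOn (fun x => x ^ (-(n : ℝ)) - |integrand n x|) (Ioi Real.pi) :=
    (integrableOn_rpow_neg hn).sub habs
  -- Strictness: the gap between `x ^ (-n)` and the integrand is nonnegative, and it is positive on
  -- `(π, 3π/2)`, where `|sin x| < 1`.
  have hpos : 0 < ∫ x in Ioi Real.pi, (x ^ (-(n : ℝ)) - |integrand n x|) := by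
    rw [setIntegral_pos_iff_support_of_nonneg_ae ?_ hsub]
    · refine lt_of_lt_of_le ?_ (measure_mono (μ := volume)
        (s := Ioo Real.pi (Real.pi + Real.pi / 2)) fun x hx => ⟨?_, hx.1⟩)
      · rw [Real.volume_Ioo]
        simp [Real.pi_pos]
      · have hx0 : 0 < x := Real.pi_pos.trans hx.1
        have h1 : |Real.sin x| ^ n < 1 :=
          pow_lt_one₀ (abs_nonneg _) (abs_sin_lt_one hx) (by omega)
        have h2 : |integrand n x| < x ^ (-(n : ℝ)) := by
          rw [integrand, abs_pow, abs_div, abs_of_pos hx0, div_pow, Real.rpow_neg hx0.le,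
            Real.rpow_natCast, div_eq_mul_inv]
          exact mul_lt_of_lt_one_left (by positivity) h1
        exact (sub_pos.2 h2).ne'
    · filter_upwards [ae_restrict_mem measurableSet_Ioi] with x hx
      exact sub_nonneg.2 (abs_integrand_le n (Real.pi_pos.trans hx))
  rw [integral_sub (integrableOn_rpow_neg hn) habs, hint, sub_pos] at hpos
  exact (abs_integral_le_integral_abs).trans_lt hpos

theorem R_isBigO : R =O[atTop] (fun n : ℕ => 1 / ((n : ℝ) * Real.pi ^ n)) := by
  -- The factor `π` comes from `π ^ (1 - n)`, the factor `2` from `n ≤ 2 (n - 1)`.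
  refine IsBigO.of_bound (2 * Real.pi) ?_
  filter_upwards [eventually_ge_atTop 2] with n hn
  have hn' : (2 : ℝ) ≤ n := by exact_mod_cast hn
  have hpi := Real.pi_pos
  rw [Real.norm_eq_abs, Real.norm_of_nonneg (by positivity)]
  refine (abs_R_lt hn).le.trans ?_
  rw [zpow_sub₀ hpi.ne', zpow_one, zpow_natCast, mul_one_div, div_div]
  rw [div_le_div_iff₀ (mul_pos (by positivity) (by linarith)) (by positivity)]
  have : 0 < Real.pi * Real.pi ^ n := by positivity
  nlinarith

/-! ### Gaussian moments and Watson's lemma -/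

theorem exp_neg_mul_isBigO {a : ℝ} (ha : 0 < a) (N : ℕ) :
    (fun n : ℕ => Real.exp (-a * n)) =O[atTop] (fun n : ℕ => 1 / (√(n : ℝ) * (n : ℝ) ^ N)) := by
  have h := ((isLittleO_exp_neg_mul_rpow_atTop ha (-(1 / 2 + (N : ℝ)))).comp_tendsto
    tendsto_natCast_atTop_atTop).isBigO
  refine h.congr' EventuallyEq.rfl ?_
  filter_upwards [eventually_gt_atTop 0] with n hn
  have hn' : (0 : ℝ) < n := by exact_mod_cast hn
  simp only [Function.comp_apply]
  rw [Real.rpow_neg hn'.le, Real.rpow_add hn', Real.rpow_natCast, ← Real.sqrt_eq_rpow, one_div]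

theorem R_isBigO_poly (N : ℕ) :
    R =O[atTop] (fun n : ℕ => 1 / (√(n : ℝ) * (n : ℝ) ^ N)) := by
  refine R_isBigO.trans (IsBigO.trans (IsBigO.of_bound 1 ?_)
    (exp_neg_mul_isBigO (Real.log_pos (by linarith [Real.pi_gt_three] : 1 < Real.pi)) N))
  filter_upwards [eventually_ge_atTop 1] with n hn
  have hn' : (1 : ℝ) ≤ n := by exact_mod_cast hn
  have hpi := Real.pi_pos
  rw [Real.norm_of_nonneg (by positivity), Real.norm_of_nonneg (by positivity), one_mul,
    neg_mul, Real.exp_neg, mul_comm (Real.log _), Real.exp_nat_mul, Real.exp_log hpi, one_div]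
  exact inv_anti₀ (by positivity) (le_mul_of_one_le_left (by positivity) hn')

theorem rpow_two_mul_exp_eq (k : ℕ) (b t : ℝ) :
    t ^ ((2 * k : ℕ) : ℝ) * Real.exp (-b * t ^ (2 : ℝ)) = t ^ (2 * k) * Real.exp (-b * t ^ 2) := by
  rw [Real.rpow_natCast, ← Real.rpow_natCast t 2]
  norm_num

theorem integrableOn_pow_mul_exp_neg_mul_sq {b : ℝ} (hb : 0 < b) (k : ℕ) :
    IntegrableOn (fun t : ℝ => t ^ (2 * k) * Real.exp (-b * t ^ 2)) (Ioi 0) := by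
  have h := (integrable_rpow_mul_exp_neg_mul_sq hb (s := ((2 * k : ℕ) : ℝ))
    (by linarith [Nat.cast_nonneg (α := ℝ) (2 * k)])).integrableOn (s := Ioi 0)
  simpa only [Real.rpow_natCast] using h

theorem integral_pow_mul_exp_neg_mul_sq {b : ℝ} (hb : 0 < b) (k : ℕ) :
    ∫ t in Ioi (0 : ℝ), t ^ (2 * k) * Real.exp (-b * t ^ 2) =
      Real.Gamma (k + 1 / 2) / 2 * (1 / (√b * b ^ k)) := by
  have h := integral_rpow_mul_exp_neg_mul_rpow (p := 2) (q := ((2 * k : ℕ) : ℝ)) (by norm_num)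
    (by linarith [Nat.cast_nonneg (α := ℝ) (2 * k)]) hb
  simp only [rpow_two_mul_exp_eq] at h
  rw [h]
  have e1 : (((2 * k : ℕ) : ℝ) + 1) / 2 = k + 1 / 2 := by push_cast; ring
  have e2 : -(((2 * k : ℕ) : ℝ) + 1) / 2 = -(1 / 2 + k) := by push_cast; ring
  rw [e1, e2, Real.rpow_neg hb.le, Real.rpow_add hb, Real.rpow_natCast, ← Real.sqrt_eq_rpow]
  ring

/-- Truncating a Gaussian moment at `ρ` costs an exponentially small amount. -/
theorem truncated_moment_isBigO {ρ : ℝ} (hρ : 0 < ρ) (k N : ℕ) :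
    (fun n : ℕ => (∫ t in (0 : ℝ)..ρ, t ^ (2 * k) * Real.exp (-(n : ℝ) * t ^ 2)) -
      Real.Gamma (k + 1 / 2) / 2 * (1 / (√(n : ℝ) * (n : ℝ) ^ k)))
      =O[atTop] (fun n : ℕ => 1 / (√(n : ℝ) * (n : ℝ) ^ N)) := by
  refine IsBigO.trans (IsBigO.of_bound (Real.exp (ρ ^ 2) *
    ∫ t in Ioi ρ, t ^ (2 * k) * Real.exp (-1 * t ^ 2)) ?_) (exp_neg_mul_isBigO (pow_pos hρ 2) N)
  filter_upwards [eventually_ge_atTop 1] with n hn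
  have hn' : (1 : ℝ) ≤ n := by exact_mod_cast hn
  have hint := integrableOn_pow_mul_exp_neg_mul_sq (zero_lt_one.trans_le hn') k
  have hint1 := (integrableOn_pow_mul_exp_neg_mul_sq zero_lt_one k).mono_set
    (Ioi_subset_Ioi hρ.le)
  have hintρ := hint.mono_set (Ioi_subset_Ioi hρ.le)
  rw [← integral_pow_mul_exp_neg_mul_sq (zero_lt_one.trans_le hn'),
    intervalIntegral.integral_of_le hρ.le, ← Ioc_union_Ioi_eq_Ioi hρ.le,
    setIntegral_union (Ioc_disjoint_Ioi le_rfl) measurableSet_Ioi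
      (hint.mono_set Ioc_subset_Ioi_self) hintρ, sub_add_cancel_left, norm_neg,
    Real.norm_of_nonneg (Real.exp_pos _).le, Real.norm_of_nonneg (setIntegral_nonneg measurableSet_Ioi
      fun t _ => mul_nonneg (Even.pow_nonneg (even_two_mul k) t) (Real.exp_pos _).le),
    mul_right_comm, ← integral_const_mul]
  refine setIntegral_mono_on hintρ (hint1.const_mul _) measurableSet_Ioi fun t ht => ?_
  have ht' : ρ < t := ht
  -- This amounts to `(n - 1) (t ^ 2 - ρ ^ 2) ≥ 0`; it extracts the decay in `n` and leaves an
  -- integrable weight independent of `n`.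
  have hexp : Real.exp (-(n : ℝ) * t ^ 2) ≤
      Real.exp (ρ ^ 2) * Real.exp (-ρ ^ 2 * n) * Real.exp (-1 * t ^ 2) := by
    rw [← Real.exp_add, ← Real.exp_add, Real.exp_le_exp]
    have : ρ ^ 2 ≤ t ^ 2 := by gcongr
    nlinarith
  calc t ^ (2 * k) * Real.exp (-(n : ℝ) * t ^ 2)
      ≤ t ^ (2 * k) * (Real.exp (ρ ^ 2) * Real.exp (-ρ ^ 2 * n) * Real.exp (-1 * t ^ 2)) :=
        mul_le_mul_of_nonneg_left hexp (Even.pow_nonneg (even_two_mul k) t)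
    _ = _ := by ring

/-- The remainder of an even power series after `N` terms is `O(t ^ (2 * N))`. -/
theorem exists_remainder_bound {ρ : ℝ} (hρ : 0 < ρ) {g : ℝ → ℝ} {a : ℕ → ℝ}
    (hg : ∀ t ∈ Icc 0 ρ, HasSum (fun k => a k * t ^ (2 * k)) (g t)) (N : ℕ) :
    ∃ C, 0 ≤ C ∧ ∀ t ∈ Icc 0 ρ,
      |g t - ∑ k ∈ Finset.range N, a k * t ^ (2 * k)| ≤ C * t ^ (2 * N) := by
  -- Convergence at the endpoint `ρ` is absolute, and it dominates the series termwise on the whole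
  -- interval.
  have hs : Summable fun k => |a (k + N)| * ρ ^ (2 * k) := by
    have h1 := (hg ρ (right_mem_Icc.2 hρ.le)).summable.abs
    have h2 := ((summable_nat_add_iff N).2 h1).mul_right ((ρ ^ (2 * N))⁻¹)
    refine h2.congr fun k => ?_
    rw [abs_mul, abs_of_pos (pow_pos hρ _), mul_add, pow_add]
    field_simp
  refine ⟨∑' k, |a (k + N)| * ρ ^ (2 * k), tsum_nonneg fun k => by positivity, fun t ht => ?_⟩
  have h := (hasSum_nat_add_iff' N).2 (hg t ht)
  have hb := hs.hasSum.mul_right (t ^ (2 * N))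
  rw [← Real.norm_eq_abs]
  refine h.norm_le_of_bounded hb fun k => ?_
  have ht0 := ht.1
  rw [Real.norm_eq_abs, abs_mul, abs_of_nonneg (pow_nonneg ht0 _), mul_add, pow_add, ← mul_assoc]
  gcongr
  exact ht.2

/-- Watson's lemma for an even power series. -/
theorem watson {ρ : ℝ} (hρ : 0 < ρ) {g : ℝ → ℝ} {a : ℕ → ℝ} (hc : ContinuousOn g (Icc 0 ρ))
    (hg : ∀ t ∈ Icc 0 ρ, HasSum (fun k => a k * t ^ (2 * k)) (g t)) (N : ℕ) :
    (fun n : ℕ => (∫ t in (0 : ℝ)..ρ, Real.exp (-(n : ℝ) * t ^ 2) * g t) -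
      ∑ k ∈ Finset.range N, a k * (Real.Gamma (k + 1 / 2) / 2 * (1 / (√(n : ℝ) * (n : ℝ) ^ k))))
      =O[atTop] (fun n : ℕ => 1 / (√(n : ℝ) * (n : ℝ) ^ N)) := by
  obtain ⟨C, hC, hrem⟩ := exists_remainder_bound hρ hg N
  set E : ℝ → ℝ := fun t => g t - ∑ k ∈ Finset.range N, a k * t ^ (2 * k) with hE
  have hcE : ContinuousOn E (uIcc 0 ρ) := by
    rw [uIcc_of_le hρ.le]
    exact hc.sub (Continuous.continuousOn (by fun_prop))
  have hintE : ∀ n : ℕ, IntervalIntegrable (fun t => Real.exp (-(n : ℝ) * t ^ 2) * E t)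
      volume 0 ρ := fun n =>
    ((Continuous.continuousOn (by fun_prop)).mul hcE).intervalIntegrable
  -- The remainder is at most `C * t ^ (2 * N)`, so its integral is bounded by the complete Gaussian
  -- moment of order `2 * N`.
  have h1 : (fun n : ℕ => ∫ t in (0 : ℝ)..ρ, Real.exp (-(n : ℝ) * t ^ 2) * E t)
      =O[atTop] (fun n : ℕ => 1 / (√(n : ℝ) * (n : ℝ) ^ N)) := by
    refine IsBigO.of_bound (C * (Real.Gamma (N + 1 / 2) / 2)) ?_
    filter_upwards [eventually_ge_atTop 1] with n hn
    have hn' : (0 : ℝ) < n := by exact_mod_cast hn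
    have hint := integrableOn_pow_mul_exp_neg_mul_sq hn' N
    rw [Real.norm_of_nonneg (r := 1 / _) (by positivity), mul_assoc,
      ← integral_pow_mul_exp_neg_mul_sq hn', ← integral_const_mul,
      intervalIntegral.integral_of_le hρ.le]
    refine (norm_integral_le_integral_norm _).trans ?_
    refine le_trans (setIntegral_mono_on ((hintE n).1.norm)
      ((hint.mono_set Ioc_subset_Ioi_self).const_mul C) measurableSet_Ioc fun t ht => ?_)
      (setIntegral_mono_set (hint.const_mul C) ?_ Ioc_subset_Ioi_self.eventuallyLE)
    · rw [norm_mul, Real.norm_of_nonneg (Real.exp_pos _).le, Real.norm_eq_abs]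
      have := mul_le_mul_of_nonneg_left (hrem t (Ioc_subset_Icc_self ht))
        (Real.exp_pos (-(n : ℝ) * t ^ 2)).le
      refine this.trans (le_of_eq (by ring))
    · exact Eventually.of_forall fun t => mul_nonneg hC
        (mul_nonneg (Even.pow_nonneg (even_two_mul N) t) (Real.exp_pos _).le)
  have h2 := IsBigO.sum (s := Finset.range N)
    fun k _ => (truncated_moment_isBigO hρ k N).const_mul_left (a k)
  refine (h1.add h2).congr_left fun n => ?_
  have hsplit : ∫ t in (0 : ℝ)..ρ, Real.exp (-(n : ℝ) * t ^ 2) * g t =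
      (∫ t in (0 : ℝ)..ρ, Real.exp (-(n : ℝ) * t ^ 2) * E t) + ∑ k ∈ Finset.range N,
        a k * ∫ t in (0 : ℝ)..ρ, t ^ (2 * k) * Real.exp (-(n : ℝ) * t ^ 2) := by
    simp only [← intervalIntegral.integral_const_mul]
    rw [← intervalIntegral.integral_finsetSum
      (fun k _ => Continuous.intervalIntegrable (by fun_prop) _ _),
      ← intervalIntegral.integral_add (hintE n) (Continuous.intervalIntegrable (by fun_prop) _ _)]
    refine intervalIntegral.integral_congr fun t _ => ?_
    simp only [hE, mul_sub, Finset.mul_sum]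
    rw [eq_comm, sub_add_eq_add_sub, sub_eq_iff_eq_add]
    congr 1
    exact Finset.sum_congr rfl fun k _ => by ring
  rw [hsplit]
  simp only [Finset.sum_apply, mul_sub, Finset.sum_sub_distrib]
  ring

/-! ### Expansion of `IHat` and `I` -/

theorem xOf_pos {ρ : ℝ} (hρ : 0 < ρ) : 0 < xOf ρ := by
  rw [← strictMonoOn_tau.lt_iff_lt ⟨by linarith [Real.pi_pos], Real.pi_pos⟩ (xOf_mem ρ),
    tau_zero, tau_xOf]
  exact hρ

theorem abs_sinc_le_exp {ρ : ℝ} (hρ : 0 < ρ) {x : ℝ} (hx : x ∈ Icc (xOf ρ) Real.pi) :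
    |Real.sinc x| ≤ Real.exp (-ρ ^ 2) := by
  have h0 : xOf ρ ∈ Icc 0 Real.pi := ⟨(xOf_pos hρ).le, (xOf_mem ρ).2.le⟩
  have h1 : x ∈ Icc 0 Real.pi := ⟨h0.1.trans hx.1, hx.2⟩
  rw [← sinc_xOf, abs_of_nonneg]
  · exact strictAntiOn_sinc.antitoneOn h0 h1 hx.1
  · rw [← sinc_pi]
    exact strictAntiOn_sinc.antitoneOn h1 (right_mem_Icc.2 Real.pi_pos.le) hx.2

theorem integral_sinc_pow_eq {ρ : ℝ} (hρ : 0 < ρ) (hx : ∀ t ∈ Icc 0 ρ, AnalyticAt ℝ xOf t)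
    (n : ℕ) : ∫ x in (0 : ℝ)..xOf ρ, Real.sinc x ^ n =
      ∫ t in (0 : ℝ)..ρ, Real.exp (-(n : ℝ) * t ^ 2) * deriv xOf t := by
  rw [← uIcc_of_le hρ.le] at hx
  have h := intervalIntegral.integral_comp_mul_deriv (a := 0) (b := ρ) (f := xOf)
    (f' := deriv xOf) (g := fun x => Real.sinc x ^ n)
    (fun t ht => (hx t ht).differentiableAt.hasDerivAt)
    (fun t ht => (hx t ht).deriv.continuousAt.continuousWithinAt) (Real.continuous_sinc.pow n)
  rw [xOf_zero] at h
  rw [← h]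
  refine intervalIntegral.integral_congr fun t _ => ?_
  simp only [Function.comp_apply, sinc_xOf]
  rw [← Real.exp_nat_mul, neg_mul, mul_neg]

theorem tail_sinc_pow_isBigO {ρ : ℝ} (hρ : 0 < ρ) (N : ℕ) :
    (fun n : ℕ => ∫ x in xOf ρ..Real.pi, Real.sinc x ^ n)
      =O[atTop] (fun n : ℕ => 1 / (√(n : ℝ) * (n : ℝ) ^ N)) := by
  refine IsBigO.trans (IsBigO.of_bound |Real.pi - xOf ρ| (Eventually.of_forall fun n => ?_))
    (exp_neg_mul_isBigO (pow_pos hρ 2) N)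
  rw [mul_comm |_|, Real.norm_of_nonneg (Real.exp_pos _).le]
  refine intervalIntegral.norm_integral_le_of_norm_le_const fun x hx => ?_
  rw [uIoc_of_le (xOf_mem ρ).2.le] at hx
  rw [norm_pow, Real.norm_eq_abs, mul_comm, Real.exp_nat_mul]
  exact pow_le_pow_left₀ (abs_nonneg _) (abs_sinc_le_exp hρ (Ioc_subset_Icc_self hx)) n

theorem IHat_eq (n : ℕ) : IHat n = ∫ x in (0 : ℝ)..Real.pi, Real.sinc x ^ n := by
  rw [IHat, intervalIntegral.integral_of_le Real.pi_pos.le,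
    intervalIntegral.integral_of_le Real.pi_pos.le]
  exact setIntegral_congr_fun measurableSet_Ioc fun x hx => integrand_eq_sinc_pow n hx.1.ne'

theorem sqrt_three_pi_div (n : ℝ) :
    √(3 * Real.pi / (2 * n)) = √6 * √Real.pi / 2 / √n := by
  have h : √(6 : ℝ) * √Real.pi / 2 = √(3 * Real.pi / 2) := by
    rw [← Real.sqrt_mul (by norm_num), eq_comm, Real.sqrt_eq_iff_mul_self_eq (by positivity)
      (by positivity), div_mul_div_comm, Real.mul_self_sqrt (by positivity)]
    ring
  rw [h, ← Real.sqrt_div (by positivity), div_div]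

/-- Matches normalizations: `√6 * Γ(1/2) / 2 = √(3π/2)` is the prefactor, and the remaining quotient
of Gamma values is the one in `c`. -/
theorem watson_term_eq {n : ℝ} (hn : 0 < n) (k : ℕ) :
    √6 * b k * (Real.Gamma (k + 1 / 2) / 2 * (1 / (√n * n ^ k))) =
      √(3 * Real.pi / (2 * n)) * (c k / n ^ k) := by
  rw [sqrt_three_pi_div n, c, Real.Gamma_one_half_eq]
  have h1 : √Real.pi ≠ 0 := by positivity
  have h2 : √n ≠ 0 := by positivity
  field_simp

theorem IHat_isBigO (N : ℕ) :
    (fun n : ℕ => IHat n - √(3 * Real.pi / (2 * (n : ℝ))) *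
          ∑ k ∈ Finset.range N, c k / (n : ℝ) ^ k)
        =O[atTop] (fun n : ℕ => 1 / (√(n : ℝ) * (n : ℝ) ^ N)) := by
  obtain ⟨r, hr, h⟩ := exists_hasSum_deriv_xOf
  -- Halving `r` keeps the closed interval `[0, ρ]` inside the open region of convergence.
  have hρ : 0 < r / 2 := half_pos hr
  have hmem : ∀ t ∈ Icc 0 (r / 2), |t| < r := fun t ht => by
    rw [abs_of_nonneg ht.1]
    linarith [ht.2]
  have hw := watson hρ (g := deriv xOf) (a := fun k => √6 * b k)
    (fun t ht => (h t (hmem t ht)).1.deriv.continuousAt.continuousWithinAt)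
    (fun t ht => by simpa only [mul_assoc] using (h t (hmem t ht)).2) N
  refine ((tail_sinc_pow_isBigO hρ N).add hw).congr' ?_ EventuallyEq.rfl
  filter_upwards [eventually_gt_atTop 0] with n hn
  have hn' : (0 : ℝ) < n := by exact_mod_cast hn
  have hcont : Continuous fun x => Real.sinc x ^ n := Real.continuous_sinc.pow n
  rw [← integral_sinc_pow_eq hρ (fun t ht => (h t (hmem t ht)).1) n, IHat_eq,
    ← intervalIntegral.integral_add_adjacent_intervals
      (hcont.intervalIntegrable 0 (xOf (r / 2))) (hcont.intervalIntegrable _ Real.pi),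
    Finset.mul_sum]
  simp only [watson_term_eq hn']
  ring

theorem I_isBigO (N : ℕ) :
    (fun n : ℕ => I n - √(3 * Real.pi / (2 * (n : ℝ))) *
          ∑ k ∈ Finset.range N, c k / (n : ℝ) ^ k)
        =O[atTop] (fun n : ℕ => 1 / (√(n : ℝ) * (n : ℝ) ^ N)) := by
  refine ((IHat_isBigO N).add (R_isBigO_poly N)).congr' ?_ EventuallyEq.rfl
  filter_upwards [eventually_ge_atTop 2] with n hn
  rw [I_eq_IHat_add_R hn]
  ring

/-! ### The integral `J` -/

/-- The half-angle formula `1 - cos x = 2 sin² (x / 2)`; at `x = 0` both bases are `0 / 0 = 0`. -/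
theorem integrandJ_eq (n : ℕ) (x : ℝ) : integrandJ n x = integrand (2 * n) (2⁻¹ * x) := by
  rw [integrandJ, integrand, pow_mul]
  congr 1
  have h : Real.cos x = 1 - 2 * Real.sin (2⁻¹ * x) ^ 2 := by
    have h1 := Real.cos_two_mul (2⁻¹ * x)
    have h2 := Real.sin_sq_add_cos_sq (2⁻¹ * x)
    rw [show 2 * (2⁻¹ * x) = x by ring] at h1
    linarith
  rw [h]
  rcases eq_or_ne x 0 with rfl | hx
  · simp
  · field_simp
    ring

theorem integrableOn_integrandJ {n : ℕ} (hn : 1 ≤ n) : IntegrableOn (integrandJ n) (Ioi 0) := by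
  have h := integrableOn_integrand (n := 2 * n) (by omega)
  rw [show integrandJ n = fun x => integrand (2 * n) (2⁻¹ * x) from funext (integrandJ_eq n),
    integrableOn_Ioi_comp_mul_left_iff _ _ (by norm_num), mul_zero]
  exact h

theorem J_eq (n : ℕ) : J n = 2 * I (2 * n) := by
  have h := integral_comp_mul_left_Ioi (integrand (2 * n)) 0 (b := 2⁻¹) (by norm_num)
  simpa only [J, I, integrandJ_eq, mul_zero, inv_inv, smul_eq_mul] using h

theorem J_isBigO (N : ℕ) :
    (fun n : ℕ => J n - √(3 * Real.pi / (n : ℝ)) *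
          ∑ k ∈ Finset.range N, c k / (2 * (n : ℝ)) ^ k)
        =O[atTop] (fun n : ℕ => 1 / (√(n : ℝ) * (n : ℝ) ^ N)) := by
  have ht : Tendsto (fun n : ℕ => 2 * n) atTop atTop :=
    tendsto_id.const_mul_atTop' (by norm_num)
  have h := ((I_isBigO N).comp_tendsto ht).const_mul_left 2
  refine (h.congr_left fun n => ?_).trans (IsBigO.of_bound 1 ?_)
  · have h4 : √(3 * Real.pi / (n : ℝ)) = 2 * √(3 * Real.pi / (2 * (2 * (n : ℝ)))) := by
      rw [show 3 * Real.pi / (n : ℝ) = 2 ^ 2 * (3 * Real.pi / (2 * (2 * (n : ℝ)))) by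
        rcases eq_or_ne (n : ℝ) 0 with h | h
        · simp [h]
        · field_simp, Real.sqrt_mul (by norm_num), Real.sqrt_sq (by norm_num)]
    simp only [Function.comp_apply, J_eq, h4]
    push_cast
    ring
  · filter_upwards [eventually_gt_atTop 0] with n hn
    have hn' : (0 : ℝ) < n := by exact_mod_cast hn
    simp only [Function.comp_apply]
    rw [Real.norm_of_nonneg (by positivity), Real.norm_of_nonneg (by positivity), one_mul]
    push_cast
    gcongr <;> linarith

end SincPower

theorem mainTheorem1 :
    -- the inversion of `τ² = log (x / sin x)` and the expansion of `dx/dτ`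
    (Set.BijOn SincPower.tau (Set.Ioo (-Real.pi) Real.pi) Set.univ ∧
      (∀ x ∈ Set.Ioo (-Real.pi) Real.pi,
        SincPower.tau x ^ 2 = SincPower.psi x ∧ SincPower.xOf (SincPower.tau x) = x) ∧
      ∃ r : ℝ, 0 < r ∧ ∀ t : ℝ, |t| < r →
        DifferentiableAt ℝ SincPower.xOf t ∧
        HasSum (fun k : ℕ => √6 * (SincPower.b k * t ^ (2 * k))) (deriv SincPower.xOf t)) ∧
    -- splitting of the integral, and the exponentially small tail
    ((∀ n : ℕ, 2 ≤ n →
        IntegrableOn (SincPower.integrand n) (Set.Ioi 0) ∧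
        SincPower.I n = SincPower.IHat n + SincPower.R n ∧
        |SincPower.R n| < Real.pi ^ (1 - (n : ℤ)) / ((n : ℝ) - 1)) ∧
      SincPower.R =O[atTop] (fun n : ℕ => 1 / ((n : ℝ) * Real.pi ^ n))) ∧
    -- the asymptotic expansion, for the main part and for the full integral
    (∀ N : ℕ,
      (fun n : ℕ => SincPower.IHat n - √(3 * Real.pi / (2 * (n : ℝ))) *
          ∑ k ∈ Finset.range N, SincPower.c k / (n : ℝ) ^ k)
        =O[atTop] (fun n : ℕ => 1 / (√(n : ℝ) * (n : ℝ) ^ N))) ∧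
    (∀ N : ℕ,
      (fun n : ℕ => SincPower.I n - √(3 * Real.pi / (2 * (n : ℝ))) *
          ∑ k ∈ Finset.range N, SincPower.c k / (n : ℝ) ^ k)
        =O[atTop] (fun n : ℕ => 1 / (√(n : ℝ) * (n : ℝ) ^ N))) ∧
    -- the first coefficients
    (SincPower.c 0 = 1 ∧
      SincPower.c 1 = -(3 / 20) ∧
      SincPower.c 2 = -(13 / 1120) ∧
      SincPower.c 3 = 27 / 3200 ∧
      SincPower.c 4 = 52791 / 3942400 ∧
      SincPower.c 5 = 482427 / 66560000 ∧
      SincPower.c 6 = -(124996631 / 10035200000) ∧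
      SincPower.c 7 = -(5270328789 / 136478720000) ∧
      SincPower.c 8 = -(7479063506161 / 268461670400000) ∧
      SincPower.c 9 = 6921977624613 / 56518246400000 ∧
      SincPower.c 10 = 10703530420192887741 / 23658537943040000000 ∧
      SincPower.c 11 = 5097105795373974189 / 20572641689600000000 ∧
      SincPower.c 12 = -(12397974207837236059539 / 3620784937369600000000)) ∧
    -- the related integral `J n`
    (∀ n : ℕ, 1 ≤ n →
      IntegrableOn (SincPower.integrandJ n) (Set.Ioi 0) ∧
      SincPower.J n = 2 * SincPower.I (2 * n)) ∧
    (∀ N : ℕ,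
      (fun n : ℕ => SincPower.J n - √(3 * Real.pi / (n : ℝ)) *
          ∑ k ∈ Finset.range N, SincPower.c k / (2 * (n : ℝ)) ^ k)
        =O[atTop] (fun n : ℕ => 1 / (√(n : ℝ) * (n : ℝ) ^ N))) := by
  refine ⟨⟨SincPower.bijOn_tau, fun x hx => ⟨SincPower.tau_sq hx, SincPower.xOf_tau hx⟩, ?_⟩,
    ⟨fun n hn => ⟨SincPower.integrableOn_integrand hn, SincPower.I_eq_IHat_add_R hn,
      SincPower.abs_R_lt hn⟩, SincPower.R_isBigO⟩,
    SincPower.IHat_isBigO, SincPower.I_isBigO, SincPower.c_values,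
    fun n hn => ⟨SincPower.integrableOn_integrandJ hn, SincPower.J_eq n⟩, SincPower.J_isBigO⟩
  obtain ⟨r, hr, h⟩ := SincPower.exists_hasSum_deriv_xOf
  exact ⟨r, hr, fun t ht => ⟨(h t ht).1.differentiableAt, (h t ht).2⟩⟩
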